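/- For a finite simple graph $G$ and $m \in \mathbb{N}$, let $P(G,m)$ denote the number of proper colorings of $G$ with colors from $\{1,\dots,m\}$ (the value at $m$ of the chromatic polynomial). An $m$-assignment $L$ for $G$ gives each vertex $v$ a set $L(v)$ of exactly $m$ colors; $P(G,L)$ denotes the number of proper colorings $f$ of $G$ with $f(v) \in L(v)$ for every vertex $v$. The list color function $P_\ell(G,m)$ is the minimum of $P(G,L)$ over all $m$-assignments $L$ for $G$. Let $K_{2,n}$ be the complete bipartite graph with partite sets of sizes $2$ and $n$. Then: (i) $P_\ell(K_{2,n},3) = P(K_{2,n},3)$ whenever $2 \le n \le 10$, and $P_\ell(K_{2,n},3) < P(K_{2,n},3)$ whenever $n \ge 12$; (ii) $P_\ell(K_{2,n},4) = P(K_{2,n},4)$ whenever $2 \le n \le 24$, and $P_\ell(K_{2,n},4) < P(K_{2,n},4)$ whenever $n \ge 27$; (iii) $P_\ell(K_{2,n},5) = P(K_{2,n},5)$ whenever $2 \le n \le 43$, and $P_\ell(K_{2,n},5) < P(K_{2,n},5)$ whenever $n \ge 44$. -/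

import Mathlib

/-- The value `P(G, m)` of the chromatic polynomial: the number of proper colorings of `G` with
colors from a fixed set of `m` colors. -/
noncomputable def chromaticCount {V : Type*} (G : SimpleGraph V) (m : ℕ) : ℕ :=
  Nat.card (G.Coloring (Fin m))

/-- `L` is an `m`-assignment: it gives every vertex a list of exactly `m` colors.  Colors are
natural numbers, which is no restriction for finite graphs. -/
def IsListAssignment {V : Type*} (m : ℕ) (L : V → Finset ℕ) : Prop :=
  ∀ v, (L v).card = m

/-- The number `P(G, L)` of proper `L`-colorings of `G`: proper colorings `f` with `f v ∈ L v`
for every vertex `v`. -/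
noncomputable def listColoringCount {V : Type*} (G : SimpleGraph V) (L : V → Finset ℕ) : ℕ :=
  Nat.card {f : G.Coloring ℕ // ∀ v, f v ∈ L v}

/-- The list color function `P_ℓ(G, m)`: the minimum of `P(G, L)` over all `m`-assignments `L`
for `G`. -/
noncomputable def listColorFunction {V : Type*} (G : SimpleGraph V) (m : ℕ) : ℕ :=
  sInf {k : ℕ | ∃ L : V → Finset ℕ, IsListAssignment m L ∧ listColoringCount G L = k}

/-- On a finite graph there are finitely many `L`-colorings, so `listColoringCount` is a genuine
count. -/
theorem finite_listColorings {V : Type*} [Finite V] (G : SimpleGraph V) (L : V → Finset ℕ) :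
    Finite {f : G.Coloring ℕ // ∀ v, f v ∈ L v} :=
  Finite.of_injective
    (fun f => (fun v => ⟨f.1 v, f.2 v⟩ : (v : V) → {c // c ∈ L v}))
    (fun _ _ h => Subtype.ext (RelHom.ext fun v => congrArg Subtype.val (congrFun h v)))

/-- The minimum in the definition of `listColorFunction` is attained. -/
theorem exists_listColoringCount_eq {V : Type*} (G : SimpleGraph V) (m : ℕ) :
    ∃ L : V → Finset ℕ, IsListAssignment m L ∧ listColoringCount G L = listColorFunction G m :=
  Nat.sInf_mem (s := {k : ℕ | ∃ L : V → Finset ℕ, IsListAssignment m L ∧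
    listColoringCount G L = k})
    ⟨_, fun _ => Finset.range m, fun _ => Finset.card_range m, rfl⟩

/-- The sum over `a ∈ A`, `b ∈ B` of the number of ways to choose one color from every list `l i`
while avoiding `a` and `b`. -/
def pairCount {ι : Type*} [Fintype ι] (A B : Finset ℕ) (l : ι → Finset ℕ) : ℕ :=
  ∑ p ∈ A ×ˢ B, ∏ i, (l i \ {p.1, p.2}).card

/-- The list colorings of a complete bipartite graph with one part of size two. -/
def listColoringEquiv {ι : Type*} (L : Fin 2 ⊕ ι → Finset ℕ) :
    {f : (completeBipartiteGraph (Fin 2) ι).Coloring ℕ // ∀ v, f v ∈ L v} ≃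
      Σ p : ↥(L (.inl 0) ×ˢ L (.inl 1)), (i : ι) → ↥(L (.inr i) \ {p.1.1, p.1.2}) where
  toFun f := ⟨⟨(f.1 (.inl 0), f.1 (.inl 1)), Finset.mem_product.2 ⟨f.2 _, f.2 _⟩⟩, fun i =>
    ⟨f.1 (.inr i), by
      have h0 : f.1 (.inl 0) ≠ f.1 (.inr i) := f.1.valid (by simp)
      have h1 : f.1 (.inl 1) ≠ f.1 (.inr i) := f.1.valid (by simp)
      simp only [Finset.mem_sdiff, Finset.mem_insert, Finset.mem_singleton, not_or]
      exact ⟨f.2 _, h0.symm, h1.symm⟩⟩⟩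
  invFun c := ⟨SimpleGraph.Coloring.mk
      (Sum.elim ![c.1.1.1, c.1.1.2] fun i => (c.2 i : ℕ)) (by
        have h : ∀ (j : Fin 2) (i : ι), ![c.1.1.1, c.1.1.2] j ≠ (c.2 i : ℕ) := by
          intro j i
          have hi := (c.2 i).2
          simp only [Finset.mem_sdiff, Finset.mem_insert, Finset.mem_singleton, not_or] at hi
          fin_cases j
          · exact Ne.symm hi.2.1
          · exact Ne.symm hi.2.2
        rintro (j | i) (j' | i') hadj
        · simp at hadj
        · exact h j i'
        · exact (h j' i).symm
        · simp at hadj), by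
      have hc := Finset.mem_product.1 c.1.2
      rintro (j | i)
      · fin_cases j
        · exact hc.1
        · exact hc.2
      · exact (Finset.mem_sdiff.1 (c.2 i).2).1⟩
  left_inv f := by
    apply Subtype.ext
    apply RelHom.ext
    rintro (j | i)
    · fin_cases j <;> rfl
    · rfl
  right_inv c := rfl

theorem listColoringCount_eq_pairCount {ι : Type*} [Fintype ι] (L : Fin 2 ⊕ ι → Finset ℕ) :
    listColoringCount (completeBipartiteGraph (Fin 2) ι) L =
      pairCount (L (.inl 0)) (L (.inl 1)) fun i => L (.inr i) := by
  classical
  rw [listColoringCount, Nat.card_congr (listColoringEquiv L), Nat.card_sigma, pairCount,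
    ← Finset.sum_coe_sort (L (.inl 0) ×ˢ L (.inl 1))
      fun p => ∏ i, (L (.inr i) \ {p.1, p.2}).card]
  refine Finset.sum_congr rfl fun p _ => ?_
  rw [Nat.card_pi]
  exact Finset.prod_congr rfl fun i _ => by rw [Nat.card_eq_fintype_card, Fintype.card_coe]

theorem chromaticCount_eq_listColoringCount {V : Type*} (G : SimpleGraph V) (m : ℕ) :
    chromaticCount G m = listColoringCount G fun _ => Finset.range m := by
  refine Nat.card_congr
    { toFun := fun f => ⟨SimpleGraph.Coloring.mk (fun v => (f v : ℕ))
        fun h => Fin.val_injective.ne (f.valid h), fun v => Finset.mem_range.2 (f v).2⟩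
      invFun := fun f => SimpleGraph.Coloring.mk
        (fun v => ⟨f.1 v, Finset.mem_range.1 (f.2 v)⟩)
        fun h e => f.1.valid h (congrArg Fin.val e)
      left_inv := fun f => rfl
      right_inv := fun f => rfl }

theorem card_sdiff_pair {l : Finset ℕ} {a b : ℕ} (hab : a ≠ b) :
    (l \ {a, b}).card = l.card - (if a ∈ l then 1 else 0) - (if b ∈ l then 1 else 0) := by
  have e : l \ {a, b} = (l.erase a).erase b := by grind
  rw [e, Finset.card_erase_eq_ite, Finset.card_erase_eq_ite]
  simp only [Finset.mem_erase]
  split_ifs <;> grind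

theorem card_sdiff_pair_self {l : Finset ℕ} {a : ℕ} :
    (l \ {a, a}).card = l.card - (if a ∈ l then 1 else 0) := by
  have e : l \ {a, a} = l.erase a := by grind
  rw [e, Finset.card_erase_eq_ite]
  split_ifs <;> simp

theorem card_sub_two_le_card_sdiff_pair (l : Finset ℕ) (a b : ℕ) :
    l.card - 2 ≤ (l \ {a, b}).card :=
  (Nat.sub_le_sub_left Finset.card_le_two _).trans (Finset.le_card_sdiff _ _)

theorem card_sub_one_le_card_sdiff_self (l : Finset ℕ) (a : ℕ) :
    l.card - 1 ≤ (l \ {a, a}).card := by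
  rw [card_sdiff_pair_self]
  split_ifs <;> omega

/-- The number `m (m - 1) ^ n + m (m - 1) (m - 2) ^ n` of proper `m`-colorings of `K_{2,n}`. -/
def bipartiteChromaticValue (m n : ℕ) : ℕ :=
  m * (m - 1) ^ n + m * (m - 1) * (m - 2) ^ n

theorem pairCount_const {ι : Type*} [Fintype ι] (A : Finset ℕ) :
    pairCount A A (fun _ : ι => A) = bipartiteChromaticValue A.card (Fintype.card ι) := by
  rw [pairCount, ← Finset.diag_union_offDiag, Finset.sum_union (Finset.disjoint_diag_offDiag A),
    bipartiteChromaticValue]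
  congr 1
  · rw [Finset.sum_diag, Finset.sum_congr rfl fun a ha => by
      rw [card_sdiff_pair_self, if_pos ha, Finset.prod_const, Finset.card_univ]]
    simp
  · have h : ∀ p ∈ A.offDiag, (∏ _i : ι, (A \ {p.1, p.2}).card) =
        (A.card - 2) ^ Fintype.card ι := by
      intro p hp
      obtain ⟨h1, h2, h3⟩ := Finset.mem_offDiag.1 hp
      rw [card_sdiff_pair h3, if_pos h1, if_pos h2, Finset.prod_const, Finset.card_univ,
        Nat.sub_sub]
    rw [Finset.sum_congr rfl h, Finset.sum_const, Finset.offDiag_card, smul_eq_mul,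
      Nat.mul_sub_one]

theorem chromaticCount_completeBipartiteGraph (m n : ℕ) :
    chromaticCount (completeBipartiteGraph (Fin 2) (Fin n)) m = bipartiteChromaticValue m n := by
  rw [chromaticCount_eq_listColoringCount, listColoringCount_eq_pairCount, pairCount_const]
  simp

/-- The weighted inequality of arithmetic and geometric means, for natural numbers. -/
theorem prod_pow_le_sum_pow {ι : Type*} (s : Finset ι) (q w : ι → ℕ) :
    (∑ i ∈ s, q i) ^ (∑ i ∈ s, q i) * ∏ i ∈ s, w i ^ q i ≤
      (∏ i ∈ s, q i ^ q i) * (∑ i ∈ s, w i) ^ (∑ i ∈ s, q i) := by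
  set Q := ∑ i ∈ s, q i with hQ
  rcases Nat.eq_zero_or_pos Q with h0 | hpos
  · have hq : ∀ i ∈ s, q i = 0 := Finset.sum_eq_zero_iff.1 (hQ ▸ h0)
    rw [h0, Finset.prod_eq_one fun i hi => by rw [hq i hi, pow_zero],
      Finset.prod_eq_one fun i hi => by rw [hq i hi, pow_zero]]
    simp
  have hQR : (0 : ℝ) < Q := by exact_mod_cast hpos
  have hsum : (∑ i ∈ s, (q i : ℝ)) = Q := by rw [hQ]; push_cast; rfl
  have key := Real.geom_mean_le_arith_mean s (fun i => (q i : ℝ)) (fun i => (w i : ℝ) / q i)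
    (fun i _ => by positivity) (by rw [hsum]; exact hQR) (fun i _ => by positivity)
  rw [hsum] at key
  have h1 : (∏ i ∈ s, ((w i : ℝ) / q i) ^ (q i : ℝ)) ≤ ((∑ i ∈ s, (w i : ℝ)) / Q) ^ Q := by
    have h2 : (∑ i ∈ s, (q i : ℝ) * ((w i : ℝ) / q i)) ≤ ∑ i ∈ s, (w i : ℝ) := by
      refine Finset.sum_le_sum fun i _ => ?_
      rcases Nat.eq_zero_or_pos (q i) with h | h
      · simp [h]
      · rw [mul_div_cancel₀]
        exact_mod_cast h.ne'
    have h3 := pow_le_pow_left₀ (by positivity) (key.trans (div_le_div_of_nonneg_right h2 hQR.le)) Q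
    rwa [Real.rpow_inv_natCast_pow (by positivity) hpos.ne'] at h3
  have h4 : (∏ i ∈ s, ((w i : ℝ) / q i) ^ (q i : ℝ)) =
      (∏ i ∈ s, (w i : ℝ) ^ q i) / ∏ i ∈ s, (q i : ℝ) ^ q i := by
    rw [← Finset.prod_div_distrib]
    refine Finset.prod_congr rfl fun i _ => ?_
    rw [Real.rpow_natCast, div_pow]
  have h5 : (0 : ℝ) < ∏ i ∈ s, (q i : ℝ) ^ q i := by
    refine Finset.prod_pos fun i _ => ?_
    rcases Nat.eq_zero_or_pos (q i) with h | h
    · simp [h]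
    · positivity
  rw [h4, div_pow, div_le_div_iff₀ h5 (by positivity)] at h1
  have h6 : (Q : ℝ) ^ Q * ∏ i ∈ s, (w i : ℝ) ^ q i ≤
      (∏ i ∈ s, (q i : ℝ) ^ q i) * (∑ i ∈ s, (w i : ℝ)) ^ Q := by
    rw [mul_comm, mul_comm (∏ i ∈ s, (q i : ℝ) ^ q i)]
    exact h1
  exact_mod_cast h6

/-- The pairs of `A ×ˢ B` that are not pairs of distinct elements of `A ∩ B`. -/
def mainPairs (A B : Finset ℕ) : Finset (ℕ × ℕ) :=
  (A ×ˢ B) \ (A ∩ B).offDiag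

@[to_additive]
theorem prod_mainPairs {M : Type*} [CommMonoid M] (A B : Finset ℕ) (f : ℕ × ℕ → M) :
    ∏ p ∈ mainPairs A B, f p =
      ((∏ c ∈ A ∩ B, f (c, c)) *
        ((∏ p ∈ (A ∩ B) ×ˢ (B \ A), f p) * ∏ p ∈ (A \ B) ×ˢ (A ∩ B), f p)) *
          ∏ p ∈ (A \ B) ×ˢ (B \ A), f p := by
  have e : mainPairs A B = ((A ∩ B).diag ∪ (((A ∩ B) ×ˢ (B \ A)) ∪ ((A \ B) ×ˢ (A ∩ B)))) ∪
      ((A \ B) ×ˢ (B \ A)) := by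
    ext ⟨a, b⟩
    simp only [mainPairs, Finset.mem_sdiff, Finset.mem_product, Finset.mem_offDiag,
      Finset.mem_union, Finset.mem_diag, Finset.mem_inter]
    grind
  rw [e, Finset.prod_union, Finset.prod_union, Finset.prod_union, Finset.prod_diag]
  all_goals
    rw [Finset.disjoint_left]
    rintro ⟨a, b⟩
    simp only [Finset.mem_sdiff, Finset.mem_product, Finset.mem_union, Finset.mem_diag,
      Finset.mem_inter]
    grind

theorem sum_product_eq_mainPairs_add_offDiag (A B : Finset ℕ) (f : ℕ × ℕ → ℕ) :
    ∑ p ∈ A ×ˢ B, f p = ∑ p ∈ mainPairs A B, f p + ∑ p ∈ (A ∩ B).offDiag, f p := by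
  refine (Finset.sum_sdiff ?_).symm
  intro p hp
  rw [Finset.mem_offDiag, Finset.mem_inter, Finset.mem_inter] at hp
  exact Finset.mem_product.2 ⟨hp.1.1, hp.2.1.2⟩

section

variable {ι : Type*} [Fintype ι] {m : ℕ} {A B : Finset ℕ} {l : ι → Finset ℕ}

theorem card_mul_pow_le_sum_prod (hl : ∀ i, (l i).card = m) (s : Finset (ℕ × ℕ)) :
    s.card * (m - 2) ^ Fintype.card ι ≤ ∑ p ∈ s, ∏ i, (l i \ {p.1, p.2}).card := by
  rw [← smul_eq_mul]
  refine Finset.card_nsmul_le_sum _ _ _ fun p _ => ?_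
  rw [← Finset.card_univ]
  exact Finset.pow_card_le_prod _ _ _ fun i _ => hl i ▸ card_sub_two_le_card_sdiff_pair _ _ _

theorem bipartiteChromaticValue_le_pairCount_self (hA : A.card = m)
    (hl : ∀ i, (l i).card = m) :
    bipartiteChromaticValue m (Fintype.card ι) ≤ pairCount A A l := by
  rw [pairCount, ← Finset.diag_union_offDiag, Finset.sum_union (Finset.disjoint_diag_offDiag A),
    bipartiteChromaticValue]
  refine add_le_add ?_ ?_
  · have h := Finset.card_nsmul_le_sum A (fun a => ∏ i, (l i \ {a, a}).card)
      ((m - 1) ^ Fintype.card ι) fun a _ => by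
        rw [← Finset.card_univ]
        exact Finset.pow_card_le_prod _ _ _ fun i _ => hl i ▸ card_sub_one_le_card_sdiff_self _ _
    rwa [hA, smul_eq_mul, ← Finset.sum_diag A fun p => ∏ i, (l i \ {p.1, p.2}).card] at h
  · have h := card_mul_pow_le_sum_prod hl A.offDiag
    rwa [Finset.offDiag_card, hA, ← Nat.mul_sub_one] at h

theorem pow_card_mul_add_sum_le_mul_prod_add {κ : Type*} (s : Finset κ) (M : ℕ) (e : κ → ℕ) :
    M ^ s.card * (M + ∑ i ∈ s, e i) ≤ M * ∏ i ∈ s, (M + e i) := by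
  classical
  induction s using Finset.induction_on with
  | empty => simp
  | insert a s ha ih =>
    rw [Finset.card_insert_of_notMem ha, Finset.sum_insert ha, Finset.prod_insert ha]
    calc M ^ (s.card + 1) * (M + (e a + ∑ i ∈ s, e i))
        ≤ (M + e a) * (M ^ s.card * (M + ∑ i ∈ s, e i)) := by
          have : 0 ≤ e a * M ^ s.card * ∑ i ∈ s, e i := Nat.zero_le _
          rw [pow_succ]
          nlinarith
      _ ≤ (M + e a) * (M * ∏ i ∈ s, (M + e i)) := Nat.mul_le_mul_left _ ih
      _ = M * ((M + e a) * ∏ i ∈ s, (M + e i)) := by ring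

theorem pow_card_succ_le_mul_prod_add_mul_sum {κ : Type*} (s : Finset κ) (M : ℕ) (g h : κ → ℕ)
    (hg : ∀ i ∈ s, g i ≤ M) (hgh : ∀ i ∈ s, M ≤ g i + h i) :
    M ^ (s.card + 1) ≤ M * ∏ i ∈ s, g i + M ^ s.card * ∑ i ∈ s, h i := by
  classical
  induction s using Finset.induction_on with
  | empty => simp
  | insert a s ha ih =>
    have ih := ih (fun i hi => hg i (Finset.mem_insert_of_mem hi))
      (fun i hi => hgh i (Finset.mem_insert_of_mem hi))
    have hp : ∏ i ∈ s, g i ≤ M ^ s.card :=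
      Finset.prod_le_pow_card _ _ _ fun i hi => hg i (Finset.mem_insert_of_mem hi)
    have ha' := hgh a (Finset.mem_insert_self _ _)
    rw [Finset.card_insert_of_notMem ha, Finset.sum_insert ha, Finset.prod_insert ha]
    calc M ^ (s.card + 1 + 1) = M * M ^ (s.card + 1) := by ring
      _ ≤ M * (M * ∏ i ∈ s, g i + M ^ s.card * ∑ i ∈ s, h i) := Nat.mul_le_mul_left _ ih
      _ = M * (∏ i ∈ s, g i) * M + M ^ (s.card + 1) * ∑ i ∈ s, h i := by ring
      _ ≤ M * (∏ i ∈ s, g i) * (g a + h a) + M ^ (s.card + 1) * ∑ i ∈ s, h i := by gcongr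
      _ = M * (g a * ∏ i ∈ s, g i) + M * (∏ i ∈ s, g i) * h a +
          M ^ (s.card + 1) * ∑ i ∈ s, h i := by ring
      _ ≤ M * (g a * ∏ i ∈ s, g i) + M * M ^ s.card * h a +
          M ^ (s.card + 1) * ∑ i ∈ s, h i := by gcongr
      _ = M * (g a * ∏ i ∈ s, g i) + M ^ (s.card + 1) * (h a + ∑ i ∈ s, h i) := by ring

theorem bipartiteChromaticValue_le_pairCount_of_card_inter_add_one (hm : 2 ≤ m)
    (hA : A.card = m) (hB : B.card = m) (hAB : (A ∩ B).card + 1 = m)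
    (hl : ∀ i, (l i).card = m) :
    bipartiteChromaticValue m (Fintype.card ι) ≤ pairCount A B l := by
  obtain ⟨M, rfl⟩ : ∃ M, m = M + 1 := ⟨m - 1, by omega⟩
  have hC : (A ∩ B).card = M := by omega
  have hA1 : (A \ B).card = 1 := by
    have := Finset.card_sdiff_add_card_inter A B
    omega
  have hB1 : (B \ A).card = 1 := by
    have := Finset.card_sdiff_add_card_inter B A
    rw [Finset.inter_comm] at this
    omega
  obtain ⟨a, ha⟩ := Finset.card_eq_one.1 hA1
  obtain ⟨b, hb⟩ := Finset.card_eq_one.1 hB1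
  have haA : a ∈ A \ B := ha ▸ Finset.mem_singleton_self a
  have hbB : b ∈ B \ A := hb ▸ Finset.mem_singleton_self b
  rw [Finset.mem_sdiff] at haA hbB
  have hab : a ≠ b := fun h => hbB.2 (h ▸ haA.1)
  set n := Fintype.card ι with hn
  set e : ℕ → ι → ℕ := fun c i => if c ∈ l i then 0 else 1 with he
  set h : ι → ℕ := fun i => if a ∈ l i ∧ b ∈ l i then 1 else 0 with hh
  have h1 : ∀ c ∈ A ∩ B, M ^ n * (M + ∑ i, e c i) ≤ M * ∏ i, (l i \ {c, c}).card := by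
    intro c _
    have := pow_card_mul_add_sum_le_mul_prod_add Finset.univ M (e c)
    rw [Finset.card_univ] at this
    refine this.trans_eq ?_
    congr 1
    refine Finset.prod_congr rfl fun i _ => ?_
    rw [card_sdiff_pair_self, hl]
    simp only [he]
    split_ifs <;> omega
  have h2 : M ^ (n + 1) ≤ M * ∏ i, min M (l i \ {a, b}).card + M ^ n * ∑ i, h i := by
    have := pow_card_succ_le_mul_prod_add_mul_sum Finset.univ M
      (fun i => min M (l i \ {a, b}).card) h (fun i _ => min_le_left _ _) (by
        intro i _
        simp only [hh, card_sdiff_pair hab, hl]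
        split_ifs <;> grind)
    rwa [Finset.card_univ] at this
  have h3 : ∀ i, h i ≤ ∑ c ∈ A ∩ B, e c i := by
    intro i
    simp only [hh]
    split_ifs with hi
    · obtain ⟨c, hc, hcl⟩ : ∃ c ∈ A ∩ B, c ∉ l i := by
        by_contra! hcon
        have hsub : insert a (insert b (A ∩ B)) ⊆ l i := by
          intro x hx
          rw [Finset.mem_insert, Finset.mem_insert] at hx
          rcases hx with rfl | rfl | hx
          exacts [hi.1, hi.2, hcon x hx]
        have := Finset.card_le_card hsub
        rw [Finset.card_insert_of_notMem (by grind), Finset.card_insert_of_notMem (by grind),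
          hl, hC] at this
        omega
      refine le_trans ?_ (Finset.single_le_sum (fun _ _ => Nat.zero_le _) hc)
      simp [he, hcl]
    · exact Nat.zero_le _
  have h4 : ∑ i, h i ≤ ∑ c ∈ A ∩ B, ∑ i, e c i := by
    rw [Finset.sum_comm]
    exact Finset.sum_le_sum fun i _ => h3 i
  have h5 : (M + 1) * M ^ n ≤
      (∑ c ∈ A ∩ B, ∏ i, (l i \ {c, c}).card) + ∏ i, (l i \ {a, b}).card := by
    have hM : 0 < M := by omega
    refine Nat.le_of_mul_le_mul_left ?_ hM
    have h6 := Finset.sum_le_sum h1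
    rw [← Finset.mul_sum, ← Finset.mul_sum, Finset.sum_add_distrib, Finset.sum_const, hC,
      smul_eq_mul] at h6
    have h7 : M ^ n * ∑ i, h i ≤ M ^ n * ∑ c ∈ A ∩ B, ∑ i, e c i := Nat.mul_le_mul_left _ h4
    have h8 : M * ∏ i, min M (l i \ {a, b}).card ≤ M * ∏ i, (l i \ {a, b}).card := by
      gcongr
      exact min_le_right _ _
    rw [pow_succ] at h2
    nlinarith
  have h6 := card_mul_pow_le_sum_prod hl ((A ∩ B) ×ˢ (B \ A))
  have h7 := card_mul_pow_le_sum_prod hl ((A \ B) ×ˢ (A ∩ B))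
  have h8 := card_mul_pow_le_sum_prod hl (A ∩ B).offDiag
  rw [Finset.card_product, hC, hB1] at h6
  rw [Finset.card_product, hC, hA1] at h7
  rw [Finset.offDiag_card, hC] at h8
  rw [pairCount, sum_product_eq_mainPairs_add_offDiag, sum_mainPairs, bipartiteChromaticValue]
  have h9 : ∑ p ∈ (A \ B) ×ˢ (B \ A), ∏ i, (l i \ {p.1, p.2}).card =
      ∏ i, (l i \ {a, b}).card := by
    rw [ha, hb, Finset.singleton_product_singleton, Finset.sum_singleton]
  rw [h9]
  have h10 : (M + 1) * M * (M + 1 - 2) ^ n = M * 1 * (M + 1 - 2) ^ n +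
      1 * M * (M + 1 - 2) ^ n + (M * M - M) * (M + 1 - 2) ^ n := by
    rw [← add_mul, ← add_mul]
    congr 1
    have : M ≤ M * M := Nat.le_mul_self M
    zify [this]
    ring
  rw [Nat.add_sub_cancel, h10]
  linarith

end

/-- The product of `|l \ {a, b}|` over `a ∈ X` and `b ∈ Y`, when `X` and `Y` are disjoint sets of
sizes `U` and `V` that meet the `m`-element set `l` in `u` and `v` elements. -/
def rectProduct (m U u V v : ℕ) : ℕ :=
  ((m - 2) ^ v * (m - 1) ^ (V - v)) ^ u * ((m - 1) ^ v * m ^ (V - v)) ^ (U - u)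

/-- The weight exponents on `mainPairs A B`: `q.1` on the diagonal, `q.2.1` on the pairs with
exactly one entry in `A ∩ B`, and `q.2.2` on the pairs with no entry in `A ∩ B`. -/
def pairExponent (A B : Finset ℕ) (q : ℕ × ℕ × ℕ) (p : ℕ × ℕ) : ℕ :=
  if p.1 = p.2 then q.1 else if p.1 ∈ B ∨ p.2 ∈ A then q.2.1 else q.2.2

/-- The weighted product of `|l \ {a, b}|` over `mainPairs A B`, when `A`, `B` and `l` have `m`
elements, `|A ∩ B| = s`, and `l` has `t.1`, `t.2.1` and `t.2.2` elements in `A ∩ B`, `A \ B` and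
`B \ A`. -/
def typeProduct (m s : ℕ) (q t : ℕ × ℕ × ℕ) : ℕ :=
  ((m - 1) ^ t.1 * m ^ (s - t.1)) ^ q.1 *
    (rectProduct m s t.1 (m - s) t.2.2 * rectProduct m (m - s) t.2.1 s t.1) ^ q.2.1 *
      rectProduct m (m - s) t.2.1 (m - s) t.2.2 ^ q.2.2

theorem prod_ite_mem_const (X l : Finset ℕ) (α β : ℕ) :
    ∏ a ∈ X, (if a ∈ l then α else β) = α ^ (X ∩ l).card * β ^ (X.card - (X ∩ l).card) := by
  rw [Finset.prod_ite, Finset.prod_const, Finset.prod_const, Finset.filter_mem_eq_inter,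
    Finset.filter_notMem_eq_sdiff, ← Finset.card_sdiff_add_card_inter X l, Nat.add_sub_cancel]

theorem prod_product_card_sdiff {m : ℕ} {X Y l : Finset ℕ} (hXY : Disjoint X Y)
    (hl : l.card = m) :
    ∏ p ∈ X ×ˢ Y, (l \ {p.1, p.2}).card =
      rectProduct m X.card (X ∩ l).card Y.card (Y ∩ l).card := by
  rw [Finset.prod_product, rectProduct, ← prod_ite_mem_const]
  refine Finset.prod_congr rfl fun a ha => ?_
  have h : ∀ b ∈ Y, (l \ {a, b}).card =
      if b ∈ l then (if a ∈ l then m - 2 else m - 1) else (if a ∈ l then m - 1 else m) := by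
    intro b hb
    have hab : a ≠ b := by
      rintro rfl
      exact Finset.disjoint_left.1 hXY ha hb
    rw [card_sdiff_pair hab, hl]
    split_ifs <;> omega
  rw [Finset.prod_congr rfl h, prod_ite_mem_const]
  split_ifs <;> rfl

section

variable {m s : ℕ} {A B : Finset ℕ}

theorem card_sdiff_of_card_inter (hA : A.card = m) (hs : (A ∩ B).card = s) :
    (A \ B).card = m - s := by
  have := Finset.card_sdiff_add_card_inter A B
  omega

@[to_additive]
theorem prod_mainPairs_pairExponent {M : Type*} [CommMonoid M] (q : ℕ × ℕ × ℕ)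
    (f : ℕ × ℕ → ℕ → M) :
    ∏ p ∈ mainPairs A B, f p (pairExponent A B q p) =
      ((∏ c ∈ A ∩ B, f (c, c) q.1) *
        ((∏ p ∈ (A ∩ B) ×ˢ (B \ A), f p q.2.1) * ∏ p ∈ (A \ B) ×ˢ (A ∩ B), f p q.2.1)) *
          ∏ p ∈ (A \ B) ×ˢ (B \ A), f p q.2.2 := by
  rw [prod_mainPairs]
  congr 1
  · congr 1
    · exact Finset.prod_congr rfl fun c _ => by simp [pairExponent]
    · congr 1 <;> refine Finset.prod_congr rfl fun p hp => ?_ <;>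
        simp only [Finset.mem_product, Finset.mem_sdiff, Finset.mem_inter] at hp <;>
        rw [pairExponent, if_neg (by grind), if_pos (by grind)]
  · refine Finset.prod_congr rfl fun p hp => ?_
    simp only [Finset.mem_product, Finset.mem_sdiff] at hp
    rw [pairExponent, if_neg (by grind), if_neg (by grind)]

/-- The sum of the weight exponents. -/
def exponentSum (m s : ℕ) (q : ℕ × ℕ × ℕ) : ℕ :=
  s * q.1 + 2 * s * (m - s) * q.2.1 + (m - s) ^ 2 * q.2.2

/-- The product of `e ^ e` over the weight exponents `e`. -/
def exponentProduct (m s : ℕ) (q : ℕ × ℕ × ℕ) : ℕ :=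
  q.1 ^ (q.1 * s) * q.2.1 ^ (q.2.1 * (2 * s * (m - s))) * q.2.2 ^ (q.2.2 * (m - s) ^ 2)

theorem sum_pairExponent (hA : A.card = m) (hB : B.card = m) (hs : (A ∩ B).card = s)
    (q : ℕ × ℕ × ℕ) :
    ∑ p ∈ mainPairs A B, pairExponent A B q p = exponentSum m s q := by
  have hA' := card_sdiff_of_card_inter hA hs
  have hB' := card_sdiff_of_card_inter hB (Finset.inter_comm A B ▸ hs)
  rw [sum_mainPairs_pairExponent q fun _ e => e]
  simp only [Finset.sum_const, Finset.card_product, hs, hA', hB', smul_eq_mul, exponentSum]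
  ring

theorem prod_pairExponent_pow (hA : A.card = m) (hB : B.card = m) (hs : (A ∩ B).card = s)
    (q : ℕ × ℕ × ℕ) :
    ∏ p ∈ mainPairs A B, pairExponent A B q p ^ pairExponent A B q p =
      exponentProduct m s q := by
  have hA' := card_sdiff_of_card_inter hA hs
  have hB' := card_sdiff_of_card_inter hB (Finset.inter_comm A B ▸ hs)
  rw [prod_mainPairs_pairExponent q fun _ e => e ^ e]
  simp only [Finset.prod_const, Finset.card_product, hs, hA', hB', exponentProduct]
  ring

theorem prod_card_sdiff_pow_pairExponent (hA : A.card = m) (hB : B.card = m)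
    (hs : (A ∩ B).card = s) {l : Finset ℕ} (hl : l.card = m) (q : ℕ × ℕ × ℕ) :
    ∏ p ∈ mainPairs A B, (l \ {p.1, p.2}).card ^ pairExponent A B q p =
      typeProduct m s q ((A ∩ B ∩ l).card, ((A \ B) ∩ l).card, ((B \ A) ∩ l).card) := by
  have hA' := card_sdiff_of_card_inter hA hs
  have hB' := card_sdiff_of_card_inter hB (Finset.inter_comm A B ▸ hs)
  rw [prod_mainPairs_pairExponent q fun p e => (l \ {p.1, p.2}).card ^ e, Finset.prod_pow,
    Finset.prod_pow, Finset.prod_pow, Finset.prod_pow, ← mul_pow,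
    prod_product_card_sdiff (by rw [Finset.disjoint_left]; grind) hl,
    prod_product_card_sdiff (by rw [Finset.disjoint_left]; grind) hl,
    prod_product_card_sdiff (by rw [Finset.disjoint_left]; grind) hl, hs, hA', hB', typeProduct]
  congr 3
  rw [← hs, ← prod_ite_mem_const]
  refine Finset.prod_congr rfl fun c _ => ?_
  rw [card_sdiff_pair_self, hl]
  split_ifs <;> rfl

/-- The numerical conditions under which the weighted inequality of arithmetic and geometric means
with exponents `q` bounds `pairCount` from below, where `t` is the worst type of a list. -/
def IsCertificate (m s : ℕ) (q t : ℕ × ℕ × ℕ) (ns : Finset ℕ) : Prop :=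
  (∀ z ∈ Finset.range (s + 1), ∀ x ∈ Finset.range (m - s + 1), ∀ y ∈ Finset.range (m - s + 1),
    z + x + y ≤ m → typeProduct m s q t ≤ typeProduct m s q (z, x, y)) ∧
  0 < exponentProduct m s q ∧ 0 < exponentSum m s q ∧
  ∀ n ∈ ns, exponentProduct m s q *
      (bipartiteChromaticValue m n - s * (s - 1) * (m - 2) ^ n) ^ exponentSum m s q ≤
    exponentSum m s q ^ exponentSum m s q * typeProduct m s q t ^ n

instance (m s : ℕ) (q t : ℕ × ℕ × ℕ) (ns : Finset ℕ) : Decidable (IsCertificate m s q t ns) := by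
  unfold IsCertificate
  infer_instance

theorem bipartiteChromaticValue_le_pairCount_of_isCertificate {ι : Type*} [Fintype ι]
    {l : ι → Finset ℕ} (hA : A.card = m) (hB : B.card = m) (hs : (A ∩ B).card = s)
    (hl : ∀ i, (l i).card = m) {q t : ℕ × ℕ × ℕ} {ns : Finset ℕ}
    (hc : IsCertificate m s q t ns) (hn : Fintype.card ι ∈ ns) :
    bipartiteChromaticValue m (Fintype.card ι) ≤ pairCount A B l := by
  obtain ⟨ht, hpos, hQ, hns⟩ := hc
  set w : ℕ × ℕ → ℕ := fun p => ∏ i, (l i \ {p.1, p.2}).card with hw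
  have h1 := prod_pow_le_sum_pow (mainPairs A B) (pairExponent A B q) w
  rw [sum_pairExponent hA hB hs, prod_pairExponent_pow hA hB hs] at h1
  have h2 : typeProduct m s q t ^ Fintype.card ι ≤
      ∏ p ∈ mainPairs A B, w p ^ pairExponent A B q p := by
    simp only [hw, ← Finset.prod_pow]
    rw [Finset.prod_comm, ← Finset.card_univ]
    refine Finset.pow_card_le_prod _ _ _ fun i _ => ?_
    rw [prod_card_sdiff_pow_pairExponent hA hB hs (hl i)]
    refine ht _ ?_ _ ?_ _ ?_ ?_
    · rw [Finset.mem_range, ← hs, Nat.lt_succ_iff]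
      exact Finset.card_le_card Finset.inter_subset_left
    · rw [Finset.mem_range, ← card_sdiff_of_card_inter hA hs, Nat.lt_succ_iff]
      exact Finset.card_le_card Finset.inter_subset_left
    · rw [Finset.mem_range, ← card_sdiff_of_card_inter hB (Finset.inter_comm A B ▸ hs),
        Nat.lt_succ_iff]
      exact Finset.card_le_card Finset.inter_subset_left
    · rw [← Finset.card_union_of_disjoint (by rw [Finset.disjoint_left]; grind),
        ← Finset.card_union_of_disjoint (by rw [Finset.disjoint_left]; grind), ← hl i]
      exact Finset.card_le_card (by grind)
  have h3 : bipartiteChromaticValue m (Fintype.card ι) -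
      s * (s - 1) * (m - 2) ^ Fintype.card ι ≤ ∑ p ∈ mainPairs A B, w p := by
    refine le_of_pow_le_pow_left₀ hQ.ne' (Nat.zero_le _) ?_
    refine Nat.le_of_mul_le_mul_left ?_ hpos
    exact (hns _ hn).trans ((Nat.mul_le_mul_left _ h2).trans h1)
  have h4 := card_mul_pow_le_sum_prod hl (A ∩ B).offDiag
  rw [Finset.offDiag_card, hs, ← Nat.mul_sub_one] at h4
  rw [pairCount, sum_product_eq_mainPairs_add_offDiag]
  exact (Nat.sub_le_iff_le_add.1 h3).trans (Nat.add_le_add_left h4 _)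

end

/-- Certificates for all sizes `s < m - 1` of the intersection of the lists of the two vertices in
the part of size two show that the list color function and the chromatic polynomial agree. -/
theorem listColorFunction_eq_chromaticCount {m n : ℕ} (hm : 2 ≤ m)
    (h : ∀ s < m - 1, ∃ q t ns, IsCertificate m s q t ns ∧ n ∈ ns) :
    listColorFunction (completeBipartiteGraph (Fin 2) (Fin n)) m =
      chromaticCount (completeBipartiteGraph (Fin 2) (Fin n)) m := by
  refine le_antisymm ?_ ?_
  · rw [chromaticCount_eq_listColoringCount]
    exact Nat.sInf_le ⟨_, fun _ => Finset.card_range m, rfl⟩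
  · obtain ⟨L, hL, hLe⟩ :=
      exists_listColoringCount_eq (completeBipartiteGraph (Fin 2) (Fin n)) m
    rw [← hLe, chromaticCount_completeBipartiteGraph, listColoringCount_eq_pairCount]
    set A := L (.inl 0)
    set B := L (.inl 1)
    have hA : A.card = m := hL _
    have hB : B.card = m := hL _
    have hl : ∀ i, (L (.inr i)).card = m := fun i => hL _
    have hle : (A ∩ B).card ≤ m := hA ▸ Finset.card_le_card Finset.inter_subset_left
    suffices key : bipartiteChromaticValue m (Fintype.card (Fin n)) ≤
        pairCount A B fun i => L (.inr i) by
      rwa [Fintype.card_fin] at key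
    rcases lt_or_ge (A ∩ B).card (m - 1) with hs | hs
    · obtain ⟨q, t, ns, hc, hn⟩ := h _ hs
      exact bipartiteChromaticValue_le_pairCount_of_isCertificate hA hB rfl hl hc
        (by simpa using hn)
    rcases hle.lt_or_eq with hs' | hs'
    · exact bipartiteChromaticValue_le_pairCount_of_card_inter_add_one hm hA hB (by omega) hl
    · have h1 : A ∩ B = A := Finset.eq_of_subset_of_card_le Finset.inter_subset_left (by omega)
      have h2 : A ∩ B = B := Finset.eq_of_subset_of_card_le Finset.inter_subset_right (by omega)
      have h3 : B = A := h2.symm.trans h1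
      rw [h3]
      exact bipartiteChromaticValue_le_pairCount_self hA hl

theorem listColorFunction_three_eq {n : ℕ} (h2 : 2 ≤ n) (hn : n ≤ 10) :
    listColorFunction (completeBipartiteGraph (Fin 2) (Fin n)) 3 =
      chromaticCount (completeBipartiteGraph (Fin 2) (Fin n)) 3 := by
  refine listColorFunction_eq_chromaticCount (by norm_num) fun s hs => ?_
  have hns : n ∈ Finset.Icc 2 10 := Finset.mem_Icc.2 ⟨h2, hn⟩
  interval_cases s
  · exact ⟨(0, 0, 1), (0, 1, 2), _, by decide +kernel, hns⟩
  · exact ⟨(15, 1, 7), (1, 1, 1), _, by decide +kernel, hns⟩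

theorem listColorFunction_four_eq {n : ℕ} (h2 : 2 ≤ n) (hn : n ≤ 24) :
    listColorFunction (completeBipartiteGraph (Fin 2) (Fin n)) 4 =
      chromaticCount (completeBipartiteGraph (Fin 2) (Fin n)) 4 := by
  refine listColorFunction_eq_chromaticCount (by norm_num) fun s hs => ?_
  have hns : n ∈ Finset.Icc 2 24 := Finset.mem_Icc.2 ⟨h2, hn⟩
  interval_cases s
  · exact ⟨(0, 0, 1), (0, 2, 2), _, by decide +kernel, hns⟩
  · exact ⟨(6, 1, 3), (1, 1, 2), _, by decide +kernel, hns⟩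
  · rcases lt_or_ge n 5 with h | h
    · exact ⟨(1, 1, 1), (2, 1, 1), Finset.Ico 2 5, by decide +kernel, Finset.mem_Ico.2 ⟨h2, h⟩⟩
    · exact ⟨(94, 1, 37), (2, 1, 1), Finset.Icc 5 24, by decide +kernel,
        Finset.mem_Icc.2 ⟨h, hn⟩⟩

theorem listColorFunction_five_eq {n : ℕ} (h2 : 2 ≤ n) (hn : n ≤ 43) :
    listColorFunction (completeBipartiteGraph (Fin 2) (Fin n)) 5 =
      chromaticCount (completeBipartiteGraph (Fin 2) (Fin n)) 5 := by
  refine listColorFunction_eq_chromaticCount (by norm_num) fun s hs => ?_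
  have hns : n ∈ Finset.Icc 2 43 := Finset.mem_Icc.2 ⟨h2, hn⟩
  interval_cases s
  · exact ⟨(0, 0, 1), (0, 2, 3), _, by decide +kernel, hns⟩
  · exact ⟨(7, 1, 3), (1, 2, 2), _, by decide +kernel, hns⟩
  · rcases lt_or_ge n 3 with h | h
    · exact ⟨(1, 1, 1), (2, 1, 2), Finset.Ico 2 3, by decide +kernel, Finset.mem_Ico.2 ⟨h2, h⟩⟩
    · exact ⟨(20, 1, 7), (1, 2, 2), Finset.Icc 3 43, by decide +kernel,
        Finset.mem_Icc.2 ⟨h, hn⟩⟩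
  · rcases lt_or_ge n 9 with h | h
    · exact ⟨(1, 1, 1), (1, 2, 2), Finset.Ico 2 9, by decide +kernel, Finset.mem_Ico.2 ⟨h2, h⟩⟩
    · exact ⟨(376, 1, 155), (3, 1, 1), Finset.Icc 9 43, by decide +kernel,
        Finset.mem_Icc.2 ⟨h, hn⟩⟩

/-- The list of the `i`-th vertex in an assignment with few colorings: the first `N` vertices take
in turn the four sets made of `m - 2` common colors, one of `m - 2` and `m - 1`, and one of `m` and
`m + 1`; all later vertices take `Finset.range m`. -/
def balancedList (m N i : ℕ) : Finset ℕ :=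
  if i < N then insert (m - 2 + i % 2) (insert (m + i / 2 % 2) (Finset.range (m - 2)))
  else Finset.range m

theorem card_balancedList {m : ℕ} (hm : 2 ≤ m) (N i : ℕ) : (balancedList m N i).card = m := by
  rw [balancedList]
  split_ifs
  · have h1 := Nat.mod_lt i two_pos
    have h2 := Nat.mod_lt (i / 2) two_pos
    rw [Finset.card_insert_of_notMem, Finset.card_insert_of_notMem, Finset.card_range]
    · omega
    · simp only [Finset.mem_range]
      omega
    · simp only [Finset.mem_insert, Finset.mem_range]
      omega
  · exact Finset.card_range m

/-- The value of `pairCount` for the first `n` of the lists `balancedList m N i`. -/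
def balancedPairCount (m N n : ℕ) : ℕ :=
  ∑ p ∈ Finset.range m ×ˢ insert m (insert (m + 1) (Finset.range (m - 2))),
    ∏ i ∈ Finset.range n, (balancedList m N i \ {p.1, p.2}).card

theorem balancedPairCount_succ_le {m N n : ℕ} (hn : N ≤ n) :
    balancedPairCount m N (n + 1) ≤ (m - 1) * balancedPairCount m N n := by
  rw [balancedPairCount, balancedPairCount, Finset.mul_sum]
  refine Finset.sum_le_sum fun p hp => ?_
  rw [Finset.prod_range_succ, mul_comm, balancedList, if_neg hn.not_gt]
  refine Nat.mul_le_mul_right _ ?_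
  rw [show m - 1 = ((Finset.range m).erase p.1).card by
    rw [Finset.card_erase_of_mem (Finset.mem_product.1 hp).1, Finset.card_range]]
  exact Finset.card_le_card (by grind)

theorem listColorFunction_le_balancedPairCount {m : ℕ} (hm : 2 ≤ m) (N n : ℕ) :
    listColorFunction (completeBipartiteGraph (Fin 2) (Fin n)) m ≤ balancedPairCount m N n := by
  refine Nat.sInf_le ⟨Sum.elim ![Finset.range m,
    insert m (insert (m + 1) (Finset.range (m - 2)))] fun i => balancedList m N i, ?_, ?_⟩
  · rintro (j | i)
    · fin_cases j
      · simp
      · have h1 : m + 1 ∉ Finset.range (m - 2) := by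
          rw [Finset.mem_range]
          omega
        have h2 : m ∉ insert (m + 1) (Finset.range (m - 2)) := by
          rw [Finset.mem_insert, Finset.mem_range]
          omega
        change (insert m (insert (m + 1) (Finset.range (m - 2)))).card = m
        rw [Finset.card_insert_of_notMem h2, Finset.card_insert_of_notMem h1, Finset.card_range]
        omega
    · exact card_balancedList hm N i
  · rw [listColoringCount_eq_pairCount, pairCount, balancedPairCount]
    refine Finset.sum_congr rfl fun p _ => ?_
    exact Fin.prod_univ_eq_prod_range (fun i => (balancedList m N i \ {p.1, p.2}).card) n

theorem balancedPairCount_le {m N n : ℕ} (hn : N ≤ n)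
    (h : balancedPairCount m N N ≤ m * (m - 1) ^ N) :
    balancedPairCount m N n ≤ m * (m - 1) ^ n := by
  induction n, hn using Nat.le_induction with
  | base => exact h
  | succ n hn ih =>
    refine (balancedPairCount_succ_le hn).trans ((Nat.mul_le_mul_left _ ih).trans_eq ?_)
    ring

theorem listColorFunction_lt_chromaticCount {m N n : ℕ} (hm : 3 ≤ m) (hn : N ≤ n)
    (h : balancedPairCount m N N ≤ m * (m - 1) ^ N) :
    listColorFunction (completeBipartiteGraph (Fin 2) (Fin n)) m <
      chromaticCount (completeBipartiteGraph (Fin 2) (Fin n)) m := by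
  rw [chromaticCount_completeBipartiteGraph, bipartiteChromaticValue]
  refine ((listColorFunction_le_balancedPairCount (by omega) N n).trans
    (balancedPairCount_le hn h)).trans_lt (Nat.lt_add_of_pos_right ?_)
  have h1 : 0 < m - 1 := by omega
  have h2 : 0 < m - 2 := by omega
  positivity

theorem theorem1p3 :
    ((∀ n : ℕ, 2 ≤ n → n ≤ 10 →
        listColorFunction (completeBipartiteGraph (Fin 2) (Fin n)) 3 =
          chromaticCount (completeBipartiteGraph (Fin 2) (Fin n)) 3) ∧
      (∀ n : ℕ, 12 ≤ n →
        listColorFunction (completeBipartiteGraph (Fin 2) (Fin n)) 3 <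
          chromaticCount (completeBipartiteGraph (Fin 2) (Fin n)) 3)) ∧
    ((∀ n : ℕ, 2 ≤ n → n ≤ 24 →
        listColorFunction (completeBipartiteGraph (Fin 2) (Fin n)) 4 =
          chromaticCount (completeBipartiteGraph (Fin 2) (Fin n)) 4) ∧
      (∀ n : ℕ, 27 ≤ n →
        listColorFunction (completeBipartiteGraph (Fin 2) (Fin n)) 4 <
          chromaticCount (completeBipartiteGraph (Fin 2) (Fin n)) 4)) ∧
    ((∀ n : ℕ, 2 ≤ n → n ≤ 43 →
        listColorFunction (completeBipartiteGraph (Fin 2) (Fin n)) 5 =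
          chromaticCount (completeBipartiteGraph (Fin 2) (Fin n)) 5) ∧
      (∀ n : ℕ, 44 ≤ n →
        listColorFunction (completeBipartiteGraph (Fin 2) (Fin n)) 5 <
          chromaticCount (completeBipartiteGraph (Fin 2) (Fin n)) 5)) :=
  ⟨⟨fun _ => listColorFunction_three_eq, fun _ hn =>
      listColorFunction_lt_chromaticCount (by norm_num) hn (by decide +kernel)⟩,
    ⟨fun _ => listColorFunction_four_eq, fun _ hn =>
      listColorFunction_lt_chromaticCount (by norm_num) hn (by decide +kernel)⟩,
    ⟨fun _ => listColorFunction_five_eq, fun _ hn =>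
      listColorFunction_lt_chromaticCount (by norm_num) hn (by decide +kernel)⟩⟩
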